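/- Let $n\ge 2$, $s>1$, $1<p<\infty$, $\lambda\in[n-1,n)$ and $\delta,\tau\in(0,1)$, and suppose that $$s<\frac{n+1-\lambda}{1-\delta}\qquad\text{and}\qquad p>\frac{s(n-1)-\lambda+1}{n-s(1-\delta)-\lambda+1}.$$ Let $G\subset\mathbb{R}^n$ be an $s$-John domain, that is, a bounded domain (non-empty, open, connected, bounded) for which there are a point $x_0\in G$ and a constant $c_0>0$ such that every $x\in G$ can be joined to $x_0$ by a rectifiable curve $\gamma:[0,l]\to G$ parametrized by arc length with $\gamma(0)=x$, $\gamma(l)=x_0$, $l\le c_0$ and $\operatorname{dist}(\gamma(t),\partial G)\ge t^s/c_0$ for all $t\in[0,l]$. Assume that $\dim_{\mathcal M}(\partial G)\le\lambda$, where $$\dim_{\mathcal M}(E)=\sup\Big\{a\ge 0 : \limsup_{r\to0+}\frac{\big|\bigcup_{x\in E}B^n(x,r)\big|}{r^{n-a}}=\infty\Big\}$$ is the upper Minkowski dimension of $E\subset\mathbb{R}^n$ ($|\cdot|$ is Lebesgue measure, and the supremum over the empty set is $0$). Then $G$ supports the fractional $(1,p)$-Poincaré inequality: there is a finite constant $c$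 such that for every $u\in L^p(G)$, with $u_G=\frac1{|G|}\int_G u$, $$\int_G|u(x)-u_G|\,dx\le c\left(\int_G\int_{G\cap B^n(x,\,\tau\operatorname{dist}(x,\partial G))}\frac{|u(x)-u(y)|^p}{|x-y|^{n+\delta p}}\,dy\,dx\right)^{1/p},$$ where the right-hand side is allowed to be infinite. -/

import Mathlib

open MeasureTheory Filter Topology Set
open scoped ENNReal NNReal

/-- A bounded domain: a non-empty, connected, open and bounded set. -/
def IsBoundedDomain {n : ℕ} (G : Set (EuclideanSpace ℝ (Fin n))) : Prop :=
  IsOpen G ∧ IsConnected G ∧ Bornology.IsBounded G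

/-- `G` is an `s`-John domain (used for `s ≥ 1`): a bounded domain with a point `x₀ ∈ G` and a
constant `c > 0` such that each `x ∈ G` is joined to `x₀` inside `G` by a curve `γ` of length
`l ≤ c`, parametrized by arc length on `[0, l]`, with `dist (γ t, ∂G) ≥ t ^ s / c`.
Unit speed on `[0, l]` says that `γ` has length `b - a` on each `[a, b] ⊆ [0, l]`; in particular
`γ` is rectifiable and continuous there. -/
def IsSJohnDomain {n : ℕ} (s : ℝ) (G : Set (EuclideanSpace ℝ (Fin n))) : Prop :=
  IsBoundedDomain G ∧
    ∃ x₀ ∈ G, ∃ c : ℝ, 0 < c ∧ ∀ x ∈ G,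
      ∃ (l : ℝ) (γ : ℝ → EuclideanSpace ℝ (Fin n)),
        0 ≤ l ∧ l ≤ c ∧ HasUnitSpeedOn γ (Icc 0 l) ∧ MapsTo γ (Icc 0 l) G ∧
          γ 0 = x ∧ γ l = x₀ ∧
          ∀ t ∈ Icc (0 : ℝ) l, t ^ s / c ≤ Metric.infDist (γ t) (frontier G)

/-- The `a`-dimensional Minkowski precontent `|⋃_{x ∈ E} B(x, r)| / r ^ (n - a)`, for `r > 0`. -/
noncomputable def minkowskiPrecontent {n : ℕ} (a : ℝ) (E : Set (EuclideanSpace ℝ (Fin n)))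
    (r : ℝ) : ℝ≥0∞ :=
  volume (⋃ x ∈ E, Metric.ball x r) / ENNReal.ofReal (r ^ ((n : ℝ) - a))

/-- The upper Minkowski dimension: the supremum of the `a ≥ 0` for which the `a`-dimensional
Minkowski precontent has infinite upper limit as `r → 0+`. -/
noncomputable def upperMinkowskiDim {n : ℕ} (E : Set (EuclideanSpace ℝ (Fin n))) : ℝ≥0∞ :=
  ⨆ (a : ℝ≥0) (_ : limsup (fun r : ℝ => minkowskiPrecontent (a : ℝ) E r) (𝓝[>] 0) = ∞), (a : ℝ≥0∞)

/-- `∫_G ∫_{G ∩ B(x, τ dist(x, ∂G))} |u(x) - u(y)|^p / |x - y|^(n + δp) dy dx ∈ [0, ∞]`. -/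
noncomputable def fractionalEnergy {n : ℕ} (p δ τ : ℝ) (G : Set (EuclideanSpace ℝ (Fin n)))
    (u : EuclideanSpace ℝ (Fin n) → ℝ) : ℝ≥0∞ :=
  ∫⁻ x in G, ∫⁻ y in G ∩ Metric.ball x (τ * Metric.infDist x (frontier G)),
    ENNReal.ofReal (|u x - u y| ^ p / dist x y ^ ((n : ℝ) + δ * p))

/-- `G` supports the fractional `(q, p)`-Poincaré inequality with parameters `δ`, `τ`: there is a
finite constant `c` with `∫_G |u - u_G|^q ≤ c (fractional energy)^(q/p)` for all `u ∈ L^p(G)`,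
where `u_G` is the mean value of `u` on `G`. -/
def SupportsFractionalPoincare {n : ℕ} (q p δ τ : ℝ)
    (G : Set (EuclideanSpace ℝ (Fin n))) : Prop :=
  ∃ c : ℝ≥0, ∀ u : EuclideanSpace ℝ (Fin n) → ℝ,
    MemLp u (ENNReal.ofReal p) (volume.restrict G) →
      ∫⁻ x in G, ENNReal.ofReal (|u x - ⨍ z in G, u z| ^ q) ≤
        (c : ℝ≥0∞) * fractionalEnergy p δ τ G u ^ (q / p)

/-! Write d for the distance to ∂G, and E(x) for the 1/p-th power of the inner integral of the
energy, so that ∫ E^p is the energy. Along the John curve from z to x₀ one picks disjoint Whitney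
balls, with union U(z). Hölder on each ball bounds the difference of consecutive ball averages by
the integral of d^(δ-n) E over the ball, so the averages at z and at x₀ differ by at most C ∫_{U(z)}
d^(δ-n) E (`exists_edist_average_whitneyBall_le`, `IsSJohnDomain.exists_chain`).

Partition G into small pieces P_i near centres z_i and let N(x) be the total volume of the P_i with
x ∈ U(z_i), the mass of the shadow of x. Tonelli gives ∫_G |u - c| ≤ C (∫ d^δ E + ∫ N d^(δ-n) E),
where c is the average at x₀. The first term is bounded by Hölder since G is bounded; the second
needs N d^(δ-n) ∈ L^q, with q conjugate to p.

The John condition puts the shadow of x in a ball of radius about d(x)^(1/s), so N ≤ C d^(n/s).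
Using this for all but one factor of N^q leaves ∫ N d^(-a) with a = (n-δ)q - (n/s)(q-1). By Tonelli
again this is Σ |P_i| ∫_{U(z_i)} d^(-a), and the inner integrals are at most C d(z_i)^(-b). What
remains is ∫_G d^(-b), finite for b < n - λ by the dimension bound
(`lintegral_infDist_rpow_neg_lt_top`). The hypotheses on s and p are what makes such a b available
(`exists_chain_exponents`). -/

/-! ### Curves and separated chains of times -/

theorem HasUnitSpeedOn.dist_le {X : Type*} [PseudoMetricSpace X] {γ : ℝ → X} {l : ℝ}
    (h : HasUnitSpeedOn γ (Icc 0 l)) {a b : ℝ} (ha : a ∈ Icc 0 l) (hb : b ∈ Icc 0 l)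
    (hab : a ≤ b) : dist (γ a) (γ b) ≤ b - a := by
  have h1 := h ha hb
  have h2 : edist (γ a) (γ b) ≤ eVariationOn γ (Icc 0 l ∩ Icc a b) :=
    eVariationOn.edist_le γ ⟨ha, left_mem_Icc.2 hab⟩ ⟨hb, right_mem_Icc.2 hab⟩
  rw [h1, edist_dist] at h2
  have h3 := (ENNReal.ofReal_le_ofReal_iff (by simpa using hab)).1 h2
  simpa using h3

/-- Along a `1`-Lipschitz curve, a quantity that varies by at most `g a` at distance `ρ a` from
`γ a` varies in total by at most the sum of `g` over a separated finite set of times. -/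
theorem exists_separated_chain {X : Type*} [PseudoMetricSpace X] {γ : ℝ → X} {l : ℝ}
    (hl : 0 ≤ l)
    (hγ : ∀ a ∈ Icc 0 l, ∀ b ∈ Icc 0 l, a ≤ b → dist (γ a) (γ b) ≤ b - a)
    {ρ : ℝ → ℝ} {ρ₀ : ℝ} (hρ₀ : 0 < ρ₀) (hρ : ∀ t ∈ Icc 0 l, ρ₀ ≤ ρ t) :
    ∃ T : Finset ℝ, (∀ a ∈ T, a ∈ Icc 0 l) ∧
      (∀ a ∈ T, ∀ b ∈ T, a < b → ρ a ≤ dist (γ a) (γ b)) ∧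
      ∀ (f : ℝ → ℝ) (g : ℝ → ℝ≥0∞),
        (∀ a ∈ Icc 0 l, ∀ b ∈ Icc 0 l, dist (γ a) (γ b) ≤ ρ a → edist (f a) (f b) ≤ g a) →
        edist (f 0) (f l) ≤ ∑ a ∈ T, g a := by
  -- Induction on the number of steps of length `ρ₀` that suffice to reach `l`.
  have key : ∀ k : ℕ, ∀ t ∈ Icc 0 l, l - t ≤ k * ρ₀ →
      ∃ T : Finset ℝ, (∀ a ∈ T, a ∈ Icc t l) ∧
      (∀ a ∈ T, ∀ b ∈ T, a < b → ρ a ≤ dist (γ a) (γ b)) ∧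
      ∀ (f : ℝ → ℝ) (g : ℝ → ℝ≥0∞),
        (∀ a ∈ Icc 0 l, ∀ b ∈ Icc 0 l, dist (γ a) (γ b) ≤ ρ a → edist (f a) (f b) ≤ g a) →
        edist (f t) (f l) ≤ ∑ a ∈ T, g a := by
    intro k
    induction k with
    | zero =>
      intro t ht h
      have : t = l := le_antisymm ht.2 (by simpa using h)
      subst this
      exact ⟨∅, by simp, by simp, by simp⟩
    | succ k ih =>
      intro t ht h
      have hlmem : l ∈ Icc 0 l := ⟨hl, le_rfl⟩
      have hcont : ContinuousOn (fun t' => dist (γ t) (γ t')) (Icc t l) := by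
        have hγc : ContinuousOn γ (Icc t l) := by
          have : LipschitzOnWith 1 γ (Icc t l) := by
            refine LipschitzOnWith.of_dist_le_mul fun x hx y hy => ?_
            have hx' : x ∈ Icc 0 l := ⟨ht.1.trans hx.1, hx.2⟩
            have hy' : y ∈ Icc 0 l := ⟨ht.1.trans hy.1, hy.2⟩
            rw [NNReal.coe_one, one_mul]
            rcases le_total x y with hxy | hxy
            · exact (hγ x hx' y hy' hxy).trans (by rw [dist_comm]; exact le_abs_self _)
            · rw [dist_comm]
              exact (hγ y hy' x hx' hxy).trans (le_abs_self _)
          exact this.continuousOn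
        exact (continuous_const.dist continuous_id).comp_continuousOn hγc
      have hcl : IsCompact (Icc t l ∩ (fun t' => dist (γ t) (γ t')) ⁻¹' Iic (ρ t)) :=
        isCompact_Icc.of_isClosed_subset
          (hcont.preimage_isClosed_of_isClosed isClosed_Icc isClosed_Iic) inter_subset_left
      have hρt : 0 < ρ t := hρ₀.trans_le (hρ t ht)
      -- The next time is the last one at which the curve is within `ρ t` of `γ t`. All later points
      -- are then far from `γ t`, which separates every pair of chosen times and not only
      -- neighbours.
      obtain ⟨t', ⟨⟨htt', ht'l⟩, ht'ρ⟩, hmax⟩ :=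
        hcl.exists_isGreatest ⟨t, left_mem_Icc.2 ht.2, by simpa using hρt.le⟩
      have ht' : t' ∈ Icc 0 l := ⟨ht.1.trans htt', ht'l⟩
      have hfar : ∀ b ∈ Icc 0 l, t' < b → ρ t < dist (γ t) (γ b) := by
        intro b hb hb'
        by_contra hcon
        exact absurd (hmax ⟨⟨htt'.trans hb'.le, hb.2⟩, not_lt.1 hcon⟩) (not_le.2 hb')
      rcases eq_or_lt_of_le ht'l with heq | hlt
      · subst heq
        refine ⟨{t}, by simpa using ht.2, ?_, ?_⟩
        · intro a ha b hb hab
          simp only [Finset.mem_singleton] at ha hb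
          exact absurd hab (by rw [ha, hb]; exact lt_irrefl _)
        · intro f g hfg
          simpa using hfg t ht _ hlmem ht'ρ
      · have hge : ρ t ≤ dist (γ t) (γ t') := by
          by_contra hcon
          push Not at hcon
          -- If the curve were strictly inside the ball at time `t'`, it would still be in the ball
          -- at this later time.
          set b := min l (t' + (ρ t - dist (γ t) (γ t'))) with hb
          have hb1 : t' < b := lt_min hlt (by linarith)
          have hb2 : b ∈ Icc 0 l := ⟨ht'.1.trans hb1.le, min_le_left _ _⟩
          have h1 := hfar b hb2 hb1
          have h2 := hγ t' ht' b hb2 hb1.le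
          have h3 : b ≤ t' + (ρ t - dist (γ t) (γ t')) := min_le_right _ _
          have h4 := dist_triangle (γ t) (γ t') (γ b)
          linarith
        have hstep : t + ρ₀ ≤ t' := by
          have h1 := hγ t ht t' ht' htt'
          have h2 := hρ t ht
          linarith
        obtain ⟨T, hT1, hT2, hT3⟩ := ih t' ht' (by push_cast at h; linarith)
        have htT : t ∉ T := fun hmem => by
          have := (hT1 t hmem).1
          linarith
        refine ⟨insert t T, ?_, ?_, ?_⟩
        · intro a ha
          rcases Finset.mem_insert.1 ha with rfl | ha
          · exact left_mem_Icc.2 ht.2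
          · exact ⟨htt'.trans (hT1 a ha).1, (hT1 a ha).2⟩
        · intro a ha b hb hab
          rcases Finset.mem_insert.1 ha with rfl | ha
          · rcases Finset.mem_insert.1 hb with rfl | hb
            · exact absurd hab (lt_irrefl _)
            · rcases eq_or_lt_of_le (hT1 b hb).1 with h1 | h1
              · rw [← h1]; exact hge
              · exact (hfar b ⟨ht'.1.trans (hT1 b hb).1, (hT1 b hb).2⟩ h1).le
          · rcases Finset.mem_insert.1 hb with h1 | hb
            · have := (hT1 a ha).1
              linarith
            · exact hT2 a ha b hb hab
        · intro f g hfg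
          rw [Finset.sum_insert htT]
          exact (edist_triangle _ (f t') _).trans
            (add_le_add (hfg t ht t' ht' ht'ρ) (hT3 f g hfg))
  obtain ⟨k, hk⟩ := exists_nat_ge (l / ρ₀)
  have := key k 0 ⟨le_rfl, hl⟩ (by rw [sub_zero]; exact (div_le_iff₀ hρ₀).1 hk)
  exact this

/-! ### Distance to the boundary -/

section Domain

variable {n : ℕ} {G : Set (EuclideanSpace ℝ (Fin n))}

theorem frontier_nonempty_of_isBoundedDomain (hn : n ≠ 0) (hG : IsBoundedDomain G) :
    (frontier G).Nonempty := by
  have : Nonempty (Fin n) := ⟨⟨0, Nat.pos_of_ne_zero hn⟩⟩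
  refine nonempty_frontier_iff.2 ⟨hG.2.1.nonempty, fun h => ?_⟩
  have := hG.2.2
  rw [h] at this
  exact (NormedSpace.unbounded_univ ℝ (EuclideanSpace ℝ (Fin n))) this

theorem infDist_frontier_pos (hn : n ≠ 0) (hG : IsBoundedDomain G)
    {x : EuclideanSpace ℝ (Fin n)} (hx : x ∈ G) : 0 < Metric.infDist x (frontier G) := by
  refine (isClosed_frontier.notMem_iff_infDist_pos
    (frontier_nonempty_of_isBoundedDomain hn hG)).1 fun h => ?_
  exact (disjoint_frontier_iff_isOpen.2 hG.1).le_bot ⟨h, hx⟩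

theorem ball_infDist_frontier_subset (hn : n ≠ 0) (hG : IsBoundedDomain G)
    {x : EuclideanSpace ℝ (Fin n)} (hx : x ∈ G) :
    Metric.ball x (Metric.infDist x (frontier G)) ⊆ G := by
  have hne : G ≠ univ := fun h => by
    have := frontier_nonempty_of_isBoundedDomain hn hG
    simp [h] at this
  obtain ⟨y, hy, hxy⟩ := exists_mem_frontier_infDist_compl_eq_dist hx hne
  refine (Metric.ball_subset_ball ?_).trans Metric.ball_infDist_compl_subset
  rw [hxy]
  exact Metric.infDist_le_dist_of_mem hy

theorem infDist_frontier_le_add (x y : EuclideanSpace ℝ (Fin n)) :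
    Metric.infDist x (frontier G) ≤ Metric.infDist y (frontier G) + dist x y :=
  Metric.infDist_le_infDist_add_dist

theorem exists_infDist_frontier_le (hG : IsBoundedDomain G) :
    ∃ R : ℝ, 1 ≤ R ∧ ∀ x ∈ G, Metric.infDist x (frontier G) ≤ R := by
  rcases (frontier G).eq_empty_or_nonempty with h | ⟨y, hy⟩
  · exact ⟨1, le_rfl, fun x _ => by simp [h]⟩
  obtain ⟨R, hR⟩ := hG.2.2.subset_closedBall y
  exact ⟨max 1 R, le_max_left _ _, fun x hx =>
    (Metric.infDist_le_dist_of_mem hy).trans ((hR hx).trans (le_max_right _ _))⟩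

end Domain

/-- Balls of radii `η * d z` around points at mutual distance at least `4 * η * d z` are
disjoint when `d` is `1`-Lipschitz. -/
theorem disjoint_ball_of_separated {X : Type*} [PseudoMetricSpace X] {d : X → ℝ}
    (hd : ∀ x y, d x ≤ d y + dist x y) {η : ℝ} (hη : 0 < η) (hη1 : η ≤ 1 / 2) {z w : X}
    (h : 4 * η * d z ≤ dist z w) :
    Disjoint (Metric.ball z (η * d z)) (Metric.ball w (η * d w)) := by
  rcases le_or_gt (d z) 0 with hz | hz
  · rw [Metric.ball_eq_empty.2 (mul_nonpos_of_nonneg_of_nonpos hη.le hz)]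
    exact disjoint_bot_left
  refine Metric.ball_disjoint_ball ?_
  have h1 := hd w z
  rw [dist_comm] at h1
  have h2 : η * d w ≤ η * (d z + dist z w) := by gcongr
  have h3 : η * dist z w ≤ 1 / 2 * dist z w := by gcongr
  nlinarith

/-! ### Mean values and oscillation -/

section Averages

variable {α : Type*} [MeasurableSpace α] {μ : Measure α}

theorem edist_average_le {A : Set α} {u : α → ℝ} (hA0 : μ A ≠ 0) (hA : μ A ≠ ∞)
    (hu : IntegrableOn u A μ) (c : ℝ) :
    edist (⨍ y in A, u y ∂μ) c ≤ (μ A)⁻¹ * ∫⁻ y in A, edist (u y) c ∂μ := by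
  have hne : (μ.real A) ≠ 0 := by
    rw [Measure.real, ENNReal.toReal_ne_zero]; exact ⟨hA0, hA⟩
  have h1 : (⨍ y in A, u y ∂μ) - c = (μ.real A)⁻¹ * ∫ y in A, (u y - c) ∂μ := by
    rw [integral_sub hu (integrableOn_const hA), setAverage_eq, setIntegral_const]
    simp only [smul_eq_mul]
    field_simp
  rw [edist_eq_enorm_sub, h1, enorm_mul]
  have h2 : ‖(μ.real A)⁻¹‖ₑ = (μ A)⁻¹ := by
    rw [enorm_inv hne, Measure.real, Real.enorm_eq_ofReal ENNReal.toReal_nonneg,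
      ENNReal.ofReal_toReal hA]
  rw [h2]
  gcongr
  refine (enorm_integral_le_lintegral_enorm _).trans_eq ?_
  simp only [edist_eq_enorm_sub]

theorem edist_average_average_le {A B : Set α} {u : α → ℝ} (hA0 : μ A ≠ 0) (hA : μ A ≠ ∞)
    (hB0 : μ B ≠ 0) (hB : μ B ≠ ∞) (huA : IntegrableOn u A μ) (huB : IntegrableOn u B μ) :
    edist (⨍ y in A, u y ∂μ) (⨍ y in B, u y ∂μ) ≤
      (μ A)⁻¹ * ∫⁻ x in A, (μ B)⁻¹ * ∫⁻ y in B, edist (u x) (u y) ∂μ ∂μ := by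
  refine (edist_average_le hA0 hA huA _).trans ?_
  gcongr with x
  rw [edist_comm]
  refine (edist_average_le hB0 hB huB _).trans_eq ?_
  simp only [edist_comm]

/-- Replacing the mean value over `A` by another constant at most halves the mean oscillation. -/
theorem lintegral_edist_average_le {A : Set α} {u : α → ℝ} (hA0 : μ A ≠ 0) (hA : μ A ≠ ∞)
    (hu : IntegrableOn u A μ) (c : ℝ) :
    ∫⁻ x in A, edist (u x) (⨍ y in A, u y ∂μ) ∂μ ≤ 2 * ∫⁻ x in A, edist (u x) c ∂μ := by
  calc ∫⁻ x in A, edist (u x) (⨍ y in A, u y ∂μ) ∂μ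
      ≤ ∫⁻ x in A, (edist (u x) c + edist (⨍ y in A, u y ∂μ) c) ∂μ :=
        lintegral_mono fun x => edist_triangle_right _ _ _
    _ = (∫⁻ x in A, edist (u x) c ∂μ) + edist (⨍ y in A, u y ∂μ) c * μ A := by
        rw [lintegral_add_right _ measurable_const, setLIntegral_const]
    _ ≤ (∫⁻ x in A, edist (u x) c ∂μ) +
          ((μ A)⁻¹ * ∫⁻ y in A, edist (u y) c ∂μ) * μ A := by
        gcongr
        exact edist_average_le hA0 hA hu c
    _ = 2 * ∫⁻ x in A, edist (u x) c ∂μ := by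
        rw [mul_comm (μ A)⁻¹, mul_assoc, ENNReal.inv_mul_cancel hA0 hA, mul_one, two_mul]

end Averages

/-! ### Minkowski dimension and integrability of powers of the distance -/

section Minkowski

variable {n : ℕ}

/-- An infinite upper limit at `a` would make `a` a competitor in the supremum and force `a ≤ lam`.
-/
theorem exists_volume_thickening_le {E : Set (EuclideanSpace ℝ (Fin n))} {lam a : ℝ}
    (hlam : 0 ≤ lam) (hdim : upperMinkowskiDim E ≤ ENNReal.ofReal lam) (ha : lam < a) :
    ∃ M : ℝ≥0, ∃ r₀ > 0, ∀ r, 0 < r → r < r₀ →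
      volume (⋃ x ∈ E, Metric.ball x r) ≤ M * ENNReal.ofReal (r ^ ((n : ℝ) - a)) := by
  have ha0 : 0 ≤ a := hlam.trans ha.le
  have hlim : limsup (fun r : ℝ => minkowskiPrecontent a E r) (𝓝[>] 0) ≠ ∞ := by
    intro h
    have h1 : ENNReal.ofReal a ≤ ENNReal.ofReal lam := by
      refine le_trans ?_ hdim
      refine le_iSup₂_of_le a.toNNReal ?_ le_rfl
      rwa [Real.coe_toNNReal a ha0]
    exact absurd ((ENNReal.ofReal_le_ofReal_iff hlam).1 h1) (not_le.2 ha)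
  obtain ⟨M, hM1, hM2⟩ := exists_between (lt_top_iff_ne_top.2 hlim)
  lift M to ℝ≥0 using hM2.ne
  have hev := eventually_lt_of_limsup_lt hM1
  obtain ⟨r₀, hr₀, hr⟩ := mem_nhdsGT_iff_exists_Ioo_subset.1 hev
  refine ⟨M, r₀, hr₀, fun r h0 h1 => ?_⟩
  have h2 : minkowskiPrecontent a E r < M := hr ⟨h0, h1⟩
  unfold minkowskiPrecontent at h2
  refine (ENNReal.div_le_iff ?_ ENNReal.ofReal_ne_top).1 h2.le
  exact (ENNReal.ofReal_pos.2 (Real.rpow_pos_of_pos h0 _)).ne'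

/-- Negative powers of the distance to a set of upper Minkowski dimension at most `lam` are
integrable over sets of finite measure, up to the codimension. -/
theorem lintegral_infDist_rpow_neg_lt_top {E G : Set (EuclideanSpace ℝ (Fin n))} {lam b : ℝ}
    (hE : E.Nonempty) (hG : volume G ≠ ∞) (hlam : 0 ≤ lam)
    (hdim : upperMinkowskiDim E ≤ ENNReal.ofReal lam) (hb : 0 < b) (hbl : b < n - lam) :
    ∫⁻ x in G, ENNReal.ofReal (Metric.infDist x E ^ (-b)) < ∞ := by
  -- In the layer-cake formula the set where dist(x, E) < 1/t has measure at most M t^(-c) for large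
  -- t, and t^(b-1-c) is integrable at infinity because b < c. For small t the measure of `G`
  -- suffices, because b > 0.
  obtain ⟨c, hc1, hc2⟩ := exists_between hbl
  obtain ⟨M, r₀, hr₀, hM⟩ := exists_volume_thickening_le (a := n - c) hlam hdim (by linarith)
  have hmeas : Measurable fun x : EuclideanSpace ℝ (Fin n) => (Metric.infDist x E)⁻¹ :=
    (Metric.continuous_infDist_pt E).measurable.inv
  have h1 := lintegral_rpow_eq_lintegral_meas_lt_mul (volume.restrict G)
    (f := fun x => (Metric.infDist x E)⁻¹)
    (Eventually.of_forall fun x => inv_nonneg.2 Metric.infDist_nonneg) hmeas.aemeasurable hb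
  have h2 : ∀ x, (Metric.infDist x E)⁻¹ ^ b = Metric.infDist x E ^ (-b) := fun x => by
    rw [Real.rpow_neg Metric.infDist_nonneg, Real.inv_rpow Metric.infDist_nonneg]
  simp only [h2] at h1
  rw [h1]
  refine ENNReal.mul_lt_top ENNReal.ofReal_lt_top ?_
  have ht₀ : 0 < r₀⁻¹ := inv_pos.2 hr₀
  rw [← Ioc_union_Ioi_eq_Ioi ht₀.le]
  refine (lintegral_union_le _ _ _).trans_lt (ENNReal.add_lt_top.2 ⟨?_, ?_⟩)
  · calc _ ≤ ∫⁻ t in Ioc 0 r₀⁻¹, volume G * ENNReal.ofReal (t ^ (b - 1)) := by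
          refine lintegral_mono fun t => mul_le_mul' ?_ le_rfl
          exact (measure_mono (subset_univ _)).trans_eq (Measure.restrict_apply_univ G)
      _ < ∞ := by
          rw [lintegral_const_mul' _ _ hG]
          refine ENNReal.mul_lt_top (lt_top_iff_ne_top.2 hG) ?_
          have := (intervalIntegral.intervalIntegrable_rpow' (a := 0) (b := r₀⁻¹)
            (r := b - 1) (by linarith)).1
          exact this.lintegral_lt_top
  · calc _ ≤ ∫⁻ t in Ioi r₀⁻¹, M * ENNReal.ofReal (t ^ (b - 1 - c)) := by
          refine setLIntegral_mono' measurableSet_Ioi fun t ht => ?_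
          have ht0 : 0 < t := ht₀.trans ht
          have hsub : {x | t < (Metric.infDist x E)⁻¹} ⊆ ⋃ x ∈ E, Metric.ball x t⁻¹ := by
            intro x hx
            have hx0 : 0 < Metric.infDist x E := by
              rcases Metric.infDist_nonneg (x := x) (s := E) |>.eq_or_lt with h | h
              · simp only [mem_ofPred_eq, ← h, inv_zero] at hx
                exact absurd hx (not_lt.2 ht0.le)
              · exact h
            have hx' : Metric.infDist x E < t⁻¹ := (lt_inv_comm₀ ht0 hx0).1 hx
            obtain ⟨y, hy, hxy⟩ := (Metric.infDist_lt_iff hE).1 hx'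
            exact mem_iUnion₂.2 ⟨y, hy, hxy⟩
          have hm := hM t⁻¹ (inv_pos.2 ht0) (inv_lt_of_inv_lt₀ hr₀ ht)
          calc _ ≤ (M * ENNReal.ofReal (t⁻¹ ^ ((n : ℝ) - (n - c)))) *
                ENNReal.ofReal (t ^ (b - 1)) := by
                gcongr
                exact (Measure.restrict_apply_le _ _).trans ((measure_mono hsub).trans hm)
            _ = M * ENNReal.ofReal (t ^ (b - 1 - c)) := by
                rw [mul_assoc, ← ENNReal.ofReal_mul (by positivity), Real.inv_rpow ht0.le,
                  ← Real.rpow_neg ht0.le, ← Real.rpow_add ht0]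
                ring_nf
      _ < ∞ := by
          rw [lintegral_const_mul' _ _ ENNReal.coe_ne_top]
          refine ENNReal.mul_lt_top ENNReal.coe_lt_top ?_
          exact (integrableOn_Ioi_rpow_of_lt (by linarith) ht₀).lintegral_lt_top

end Minkowski

/-! ### Local energy and Whitney balls -/

section Local

variable {n : ℕ}

/-- `∫_{G ∩ B(x, τ dist(x, ∂G))} |u(x) - u(y)|^p / |x - y|^(n + δp) dy`. -/
noncomputable def localEnergy (p δ τ : ℝ) (G : Set (EuclideanSpace ℝ (Fin n)))
    (u : EuclideanSpace ℝ (Fin n) → ℝ) (x : EuclideanSpace ℝ (Fin n)) : ℝ≥0∞ :=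
  ∫⁻ y in G ∩ Metric.ball x (τ * Metric.infDist x (frontier G)),
    ENNReal.ofReal (|u x - u y| ^ p / dist x y ^ ((n : ℝ) + δ * p))

/-- `∫_{G ∩ B(x, τ dist(x, ∂G))} |u(x) - u(y)| dy`. -/
noncomputable def localOscillation (τ : ℝ) (G : Set (EuclideanSpace ℝ (Fin n)))
    (u : EuclideanSpace ℝ (Fin n) → ℝ) (x : EuclideanSpace ℝ (Fin n)) : ℝ≥0∞ :=
  ∫⁻ y in G ∩ Metric.ball x (τ * Metric.infDist x (frontier G)), edist (u x) (u y)

theorem measurable_localEnergy {p δ τ : ℝ} {G : Set (EuclideanSpace ℝ (Fin n))}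
    (hG : MeasurableSet G) {u : EuclideanSpace ℝ (Fin n) → ℝ} (hu : Measurable u) :
    Measurable (localEnergy p δ τ G u) := by
  have hS : MeasurableSet {z : EuclideanSpace ℝ (Fin n) × EuclideanSpace ℝ (Fin n) |
      z.2 ∈ G ∧ dist z.2 z.1 < τ * Metric.infDist z.1 (frontier G)} := by
    change MeasurableSet (Prod.snd ⁻¹' G ∩ {z : EuclideanSpace ℝ (Fin n) ×
      EuclideanSpace ℝ (Fin n) | dist z.2 z.1 < τ * Metric.infDist z.1 (frontier G)})
    refine (measurable_snd hG).inter (measurableSet_lt ?_ ?_)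
    · exact measurable_snd.dist measurable_fst
    · exact ((Metric.continuous_infDist_pt _).measurable.comp measurable_fst).const_mul _
  have hf : Measurable fun z : EuclideanSpace ℝ (Fin n) × EuclideanSpace ℝ (Fin n) =>
      ENNReal.ofReal (|u z.1 - u z.2| ^ p / dist z.1 z.2 ^ ((n : ℝ) + δ * p)) := by
    fun_prop
  have hm := (hf.indicator hS).lintegral_prod_right'
    (ν := (volume : Measure (EuclideanSpace ℝ (Fin n))))
  convert hm using 1
  ext x
  rw [localEnergy, ← lintegral_indicator (hG.inter measurableSet_ball)]
  refine lintegral_congr fun y => ?_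
  by_cases h : y ∈ G ∩ Metric.ball x (τ * Metric.infDist x (frontier G))
  · rw [indicator_of_mem h, indicator_of_mem]
    exact h
  · rw [indicator_of_notMem h, indicator_of_notMem]
    exact h

theorem volume_ball_eq_ofReal_rpow_mul (z : EuclideanSpace ℝ (Fin n)) {r : ℝ} (hr : 0 < r) :
    volume (Metric.ball z r) =
      ENNReal.ofReal (r ^ (n : ℝ)) * volume (Metric.ball (0 : EuclideanSpace ℝ (Fin n)) 1) := by
  rw [Measure.addHaar_ball_of_pos volume z hr, finrank_euclideanSpace, Fintype.card_fin,
    Real.rpow_natCast]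

/-- Hölder on B(x, τd), where the kernel is inserted at the cost of |x - y| ≤ τd. The powers of d
add up to (n + δp)/p + n/q = n + δ. -/
theorem exists_localOscillation_le {p δ τ : ℝ} (hp : 1 < p) (hδ : 0 < δ) (hτ : 0 < τ) :
    ∃ C : ℝ≥0, ∀ (G : Set (EuclideanSpace ℝ (Fin n))) (u : EuclideanSpace ℝ (Fin n) → ℝ),
      Measurable u → ∀ x, 0 < Metric.infDist x (frontier G) →
        localOscillation τ G u x ≤
          C * (ENNReal.ofReal (Metric.infDist x (frontier G) ^ ((n : ℝ) + δ)) *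
            localEnergy p δ τ G u x ^ (1 / p)) := by
  have hpq := Real.HolderConjugate.conjExponent hp
  set q := p.conjExponent with hq
  have hp0 : 0 < p := by linarith
  have hq0 : 0 < q := hpq.symm.pos
  set ω := volume (Metric.ball (0 : EuclideanSpace ℝ (Fin n)) 1) with hω
  have hωt : ω ≠ ∞ := measure_ball_lt_top.ne
  refine ⟨(ENNReal.ofReal (τ ^ ((n : ℝ) + δ)) * ω ^ (1 / q)).toNNReal, fun G u hu x hx => ?_⟩
  rw [ENNReal.coe_toNNReal (ENNReal.mul_ne_top ENNReal.ofReal_ne_top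
    (ENNReal.rpow_ne_top_of_nonneg (by positivity) hωt))]
  set d := Metric.infDist x (frontier G) with hd
  set B := G ∩ Metric.ball x (τ * d) with hB
  have hτd : 0 < τ * d := mul_pos hτ hx
  have hmeas : Measurable fun y => edist (u x) (u y) := measurable_const.edist hu
  have hH := ENNReal.lintegral_mul_le_Lp_mul_Lq (volume.restrict B) hpq
    hmeas.aemeasurable (measurable_const (a := (1 : ℝ≥0∞))).aemeasurable
  simp only [Pi.mul_apply, mul_one, ENNReal.one_rpow, lintegral_const, one_mul,
    Measure.restrict_apply_univ] at hH
  have hE : ∫⁻ y in B, edist (u x) (u y) ^ p ≤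
      ENNReal.ofReal ((τ * d) ^ ((n : ℝ) + δ * p)) * localEnergy p δ τ G u x := by
    rw [localEnergy, ← lintegral_const_mul' _ _ ENNReal.ofReal_ne_top]
    refine lintegral_mono_ae ?_
    have : ∀ᵐ y ∂(volume.restrict B), y ∈ Metric.ball x (τ * d) :=
      ae_mono (Measure.restrict_mono inter_subset_right le_rfl)
        (ae_restrict_mem measurableSet_ball)
    filter_upwards [this] with y hy
    rw [edist_dist, Real.dist_eq, ENNReal.ofReal_rpow_of_nonneg (abs_nonneg _) hp0.le,
      ← ENNReal.ofReal_mul (by positivity)]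
    refine ENNReal.ofReal_le_ofReal ?_
    rcases eq_or_ne x y with rfl | hne
    · simp [Real.zero_rpow hp0.ne']
    · have hxy : 0 < dist x y := dist_pos.2 hne
      have hpow : 0 < dist x y ^ ((n : ℝ) + δ * p) := Real.rpow_pos_of_pos hxy _
      rw [mul_div_assoc', le_div_iff₀ hpow, mul_comm]
      gcongr
      rw [dist_comm]; exact (Metric.mem_ball.1 hy).le
  have hV : volume B ≤ ENNReal.ofReal ((τ * d) ^ (n : ℝ)) * ω :=
    (measure_mono inter_subset_right).trans_eq (volume_ball_eq_ofReal_rpow_mul x hτd)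
  have hexp : ((n : ℝ) + δ * p) * (1 / p) + (n : ℝ) * (1 / q) = n + δ := by
    have := hpq.inv_add_inv_eq_one
    field_simp
    field_simp at this
    linear_combination (n : ℝ) * this
  calc localOscillation τ G u x
      ≤ (∫⁻ y in B, edist (u x) (u y) ^ p) ^ (1 / p) * volume B ^ (1 / q) := hH
    _ ≤ (ENNReal.ofReal ((τ * d) ^ ((n : ℝ) + δ * p)) * localEnergy p δ τ G u x) ^ (1 / p) *
        (ENNReal.ofReal ((τ * d) ^ (n : ℝ)) * ω) ^ (1 / q) := by gcongr
    _ = (ENNReal.ofReal ((τ * d) ^ (((n : ℝ) + δ * p) * (1 / p))) *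
          ENNReal.ofReal ((τ * d) ^ ((n : ℝ) * (1 / q)))) *
        (localEnergy p δ τ G u x ^ (1 / p) * ω ^ (1 / q)) := by
        rw [ENNReal.mul_rpow_of_nonneg _ _ (by positivity),
          ENNReal.mul_rpow_of_nonneg _ _ (by positivity),
          ENNReal.ofReal_rpow_of_nonneg (by positivity) (by positivity),
          ENNReal.ofReal_rpow_of_nonneg (by positivity) (by positivity),
          ← Real.rpow_mul hτd.le, ← Real.rpow_mul hτd.le]
        ring
    _ = _ := by
        rw [← ENNReal.ofReal_mul (by positivity), ← Real.rpow_add hτd, hexp,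
          Real.mul_rpow hτ.le hx.le, ENNReal.ofReal_mul (by positivity)]
        ring

/-- `dist(x, ∂G)^δ * (localEnergy)^(1/p)`, which controls all mean oscillations near `x`. -/
noncomputable def scaledEnergy (p δ τ : ℝ) (G : Set (EuclideanSpace ℝ (Fin n)))
    (u : EuclideanSpace ℝ (Fin n) → ℝ) (x : EuclideanSpace ℝ (Fin n)) : ℝ≥0∞ :=
  ENNReal.ofReal (Metric.infDist x (frontier G) ^ δ) * localEnergy p δ τ G u x ^ (1 / p)

theorem measurable_scaledEnergy {p δ τ : ℝ} {G : Set (EuclideanSpace ℝ (Fin n))}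
    (hG : MeasurableSet G) {u : EuclideanSpace ℝ (Fin n) → ℝ} (hu : Measurable u) :
    Measurable (scaledEnergy p δ τ G u) := by
  refine Measurable.mul ?_ ((measurable_localEnergy hG hu).pow_const _)
  exact ((Metric.continuous_infDist_pt _).measurable.pow_const _).ennreal_ofReal

/-- The ball `B(z, τ/16 dist(z, ∂G))`. -/
def whitneyBall (τ : ℝ) (G : Set (EuclideanSpace ℝ (Fin n)))
    (z : EuclideanSpace ℝ (Fin n)) : Set (EuclideanSpace ℝ (Fin n)) :=
  Metric.ball z (τ / 16 * Metric.infDist z (frontier G))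

theorem whitneyBall_subset (hn : n ≠ 0) {τ : ℝ} (hτ : τ ∈ Ioo (0 : ℝ) 1)
    {G : Set (EuclideanSpace ℝ (Fin n))} (hG : IsBoundedDomain G)
    {z : EuclideanSpace ℝ (Fin n)} (hz : z ∈ G) : whitneyBall τ G z ⊆ G := by
  refine (Metric.ball_subset_ball ?_).trans (ball_infDist_frontier_subset hn hG hz)
  have := hτ.2
  exact mul_le_of_le_one_left Metric.infDist_nonneg (by linarith)

theorem infDist_le_of_mem_whitneyBall {τ : ℝ} (hτ : τ ∈ Ioo (0 : ℝ) 1)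
    {G : Set (EuclideanSpace ℝ (Fin n))} {x z : EuclideanSpace ℝ (Fin n)}
    (hx : x ∈ whitneyBall τ G z) :
    Metric.infDist x (frontier G) ≤ 17 / 16 * Metric.infDist z (frontier G) ∧
      15 / 16 * Metric.infDist z (frontier G) ≤ Metric.infDist x (frontier G) := by
  have h1 := infDist_frontier_le_add (G := G) x z
  have h2 := infDist_frontier_le_add (G := G) z x
  have h3 : dist x z < τ / 16 * Metric.infDist z (frontier G) := hx
  rw [dist_comm z x] at h2
  have h4 : τ / 16 * Metric.infDist z (frontier G) ≤ 1 / 16 * Metric.infDist z (frontier G) := by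
    have := hτ.2
    gcongr
    exact Metric.infDist_nonneg
  constructor <;> linarith

theorem exists_inv_volume_whitneyBall_le {τ : ℝ} (hτ : 0 < τ) :
    ∃ C : ℝ≥0, ∀ (G : Set (EuclideanSpace ℝ (Fin n))) (x w : EuclideanSpace ℝ (Fin n)),
      0 < Metric.infDist x (frontier G) →
      Metric.infDist x (frontier G) ≤ 2 * Metric.infDist w (frontier G) →
      (volume (whitneyBall τ G w))⁻¹ ≤
        C * ENNReal.ofReal (Metric.infDist x (frontier G) ^ (-(n : ℝ))) := by
  set ω := volume (Metric.ball (0 : EuclideanSpace ℝ (Fin n)) 1) with hω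
  have hω0 : ω ≠ 0 := (Metric.measure_ball_pos _ _ one_pos).ne'
  have hωt : ω ≠ ∞ := measure_ball_lt_top.ne
  refine ⟨(ENNReal.ofReal ((τ / 32) ^ (-(n : ℝ))) * ω⁻¹).toNNReal, fun G x w hx hxw => ?_⟩
  rw [ENNReal.coe_toNNReal (ENNReal.mul_ne_top ENNReal.ofReal_ne_top (ENNReal.inv_ne_top.2 hω0))]
  have hw : 0 < τ / 16 * Metric.infDist w (frontier G) := by
    have : 0 < Metric.infDist w (frontier G) := by linarith
    positivity
  have hle : τ / 32 * Metric.infDist x (frontier G) ≤ τ / 16 * Metric.infDist w (frontier G) := by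
    have := mul_le_mul_of_nonneg_left hxw (by positivity : 0 ≤ τ / 32)
    linarith
  have hx' : 0 < τ / 32 * Metric.infDist x (frontier G) := by positivity
  rw [whitneyBall, volume_ball_eq_ofReal_rpow_mul w hw,
    ENNReal.mul_inv (Or.inr hωt) (Or.inr hω0), ← ENNReal.ofReal_inv_of_pos (by positivity),
    ← Real.rpow_neg hw.le, mul_right_comm, ← ENNReal.ofReal_mul (by positivity),
    ← Real.mul_rpow (by positivity) hx.le]
  refine mul_le_mul' (ENNReal.ofReal_le_ofReal ?_) le_rfl
  exact Real.rpow_le_rpow_of_nonpos hx' hle (neg_nonpos.2 n.cast_nonneg)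

end Local

/-! ### Averages over neighbouring balls -/

section Oscillation

variable {n : ℕ}

/-- For x in the ball of z and w close to z, the ball of w lies in B(x, τ d(x)) and has volume
comparable to d(x)^n. So the mean of |u(x) - u(y)| over it is controlled by the local oscillation at
x. The case w = z gives the first claim; averaging over x gives the second. -/
theorem exists_edist_average_whitneyBall_le (hn : n ≠ 0) {p δ τ : ℝ} (hp : 1 < p) (hδ : 0 < δ)
    (hτ : τ ∈ Ioo (0 : ℝ) 1) :
    ∃ C : ℝ≥0, ∀ (G : Set (EuclideanSpace ℝ (Fin n))) (u : EuclideanSpace ℝ (Fin n) → ℝ),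
      IsBoundedDomain G → Measurable u → IntegrableOn u G →
      (∀ z ∈ G, ∀ x ∈ whitneyBall τ G z,
        edist (u x) (⨍ y in whitneyBall τ G z, u y) ≤ C * scaledEnergy p δ τ G u x) ∧
      ∀ z ∈ G, ∀ w ∈ G, dist z w ≤ τ / 4 * Metric.infDist z (frontier G) →
        edist (⨍ y in whitneyBall τ G z, u y) (⨍ y in whitneyBall τ G w, u y) ≤
          C * ∫⁻ x in whitneyBall τ G z,
            ENNReal.ofReal (Metric.infDist x (frontier G) ^ (-(n : ℝ))) *
              scaledEnergy p δ τ G u x := by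
  obtain ⟨C₁, hC₁⟩ := exists_localOscillation_le (n := n) hp hδ hτ.1
  obtain ⟨C₂, hC₂⟩ := exists_inv_volume_whitneyBall_le (n := n) hτ.1
  refine ⟨max (C₂ * C₁) (C₂ * (C₂ * C₁)), fun G u hG hu hui => ?_⟩
  have hA : ∀ x ∈ G, ∀ w, Metric.infDist x (frontier G) ≤ 2 * Metric.infDist w (frontier G) →
      whitneyBall τ G w ⊆ G ∩ Metric.ball x (τ * Metric.infDist x (frontier G)) →
      (volume (whitneyBall τ G w))⁻¹ * ∫⁻ y in whitneyBall τ G w, edist (u x) (u y) ≤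
        (C₂ * C₁ : ℝ≥0) * scaledEnergy p δ τ G u x := by
    intro x hx w hxw hsub
    have hx0 := infDist_frontier_pos hn hG hx
    have h1 := hC₂ G x w hx0 hxw
    have h2 : ∫⁻ y in whitneyBall τ G w, edist (u x) (u y) ≤ localOscillation τ G u x :=
      lintegral_mono_set hsub
    refine (mul_le_mul' h1 (h2.trans (hC₁ G u hu x hx0))).trans_eq ?_
    rw [scaledEnergy, Real.rpow_add hx0, ENNReal.ofReal_mul (by positivity), ENNReal.coe_mul]
    have h3 : ENNReal.ofReal (Metric.infDist x (frontier G) ^ (-(n : ℝ))) *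
        ENNReal.ofReal (Metric.infDist x (frontier G) ^ (n : ℝ)) = 1 := by
      rw [← ENNReal.ofReal_mul (by positivity), ← Real.rpow_add hx0]
      simp
    calc _ = (C₂ * C₁ * (ENNReal.ofReal (Metric.infDist x (frontier G) ^ δ) *
          localEnergy p δ τ G u x ^ (1 / p))) *
          (ENNReal.ofReal (Metric.infDist x (frontier G) ^ (-(n : ℝ))) *
            ENNReal.ofReal (Metric.infDist x (frontier G) ^ (n : ℝ))) := by ring
      _ = _ := by rw [h3, mul_one]
  have hvol : ∀ z ∈ G, volume (whitneyBall τ G z) ≠ 0 ∧ volume (whitneyBall τ G z) ≠ ∞ := by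
    intro z hz
    refine ⟨(Metric.measure_ball_pos _ _ ?_).ne', measure_ball_lt_top.ne⟩
    have h1 := infDist_frontier_pos hn hG hz
    have h2 := hτ.1
    positivity
  have hint : ∀ z ∈ G, IntegrableOn u (whitneyBall τ G z) := fun z hz =>
    hui.mono_set (whitneyBall_subset hn hτ hG hz)
  have hnear : ∀ z ∈ G, ∀ w ∈ G, dist z w ≤ τ / 4 * Metric.infDist z (frontier G) →
      ∀ x ∈ whitneyBall τ G z,
        (volume (whitneyBall τ G w))⁻¹ * ∫⁻ y in whitneyBall τ G w, edist (u x) (u y) ≤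
          (C₂ * C₁ : ℝ≥0) * scaledEnergy p δ τ G u x := by
    intro z hz w hw hzw x hx
    have hz0 := infDist_frontier_pos hn hG hz
    obtain ⟨h1, h2⟩ := infDist_le_of_mem_whitneyBall hτ hx
    have h3 := infDist_frontier_le_add (G := G) z w
    have h4 := infDist_frontier_le_add (G := G) w z
    rw [dist_comm w z] at h4
    have hτ0 := hτ.1
    have hτ1 := hτ.2
    refine hA x (whitneyBall_subset hn hτ hG hz hx) w (by nlinarith) fun y hy =>
      ⟨whitneyBall_subset hn hτ hG hw hy, ?_⟩
    have h5 : dist y w < τ / 16 * Metric.infDist w (frontier G) := hy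
    have h6 : dist x z < τ / 16 * Metric.infDist z (frontier G) := hx
    have h7 := dist_triangle4 y w z x
    rw [dist_comm w z, dist_comm z x] at h7
    have h8 : τ / 16 * Metric.infDist w (frontier G) ≤
        τ / 16 * (5 / 4 * Metric.infDist z (frontier G)) := by
      gcongr
      nlinarith
    have h9 : τ * (15 / 16 * Metric.infDist z (frontier G)) ≤
        τ * Metric.infDist x (frontier G) := by gcongr
    rw [Metric.mem_ball]
    have h10 : 0 < τ * Metric.infDist z (frontier G) := by positivity
    linarith
  refine ⟨fun z hz x hx => ?_, fun z hz w hw hzw => ?_⟩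
  · rw [edist_comm]
    refine (edist_average_le (hvol z hz).1 (hvol z hz).2 (hint z hz) _).trans ?_
    simp only [edist_comm _ (u x)]
    refine (hnear z hz z hz ?_ x hx).trans ?_
    · rw [dist_self]
      exact mul_nonneg (by linarith [hτ.1]) Metric.infDist_nonneg
    · gcongr
      exact le_max_left _ _
  · refine (edist_average_average_le (hvol z hz).1 (hvol z hz).2 (hvol w hw).1 (hvol w hw).2
      (hint z hz) (hint w hw)).trans ?_
    rw [← lintegral_const_mul' _ _ (ENNReal.inv_ne_top.2 (hvol z hz).1),
      ← lintegral_const_mul' _ _ ENNReal.coe_ne_top]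
    refine setLIntegral_mono' Metric.isOpen_ball.measurableSet fun x hx => ?_
    have h1 := hnear z hz w hw hzw x hx
    have hxd := infDist_le_of_mem_whitneyBall hτ hx
    have h2 := hC₂ G x z (infDist_frontier_pos hn hG (whitneyBall_subset hn hτ hG hz hx))
      (by linarith [infDist_frontier_pos hn hG hz])
    refine (mul_le_mul' h2 h1).trans ?_
    calc _ = ((C₂ * (C₂ * C₁) : ℝ≥0) : ℝ≥0∞) *
          (ENNReal.ofReal (Metric.infDist x (frontier G) ^ (-(n : ℝ))) *
              scaledEnergy p δ τ G u x) := by push_cast; ring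
      _ ≤ _ := by
        gcongr
        exact le_max_right _ _

end Oscillation

/-! ### Real exponents and sums along the curve -/

section RealEstimates

theorem rpow_le_two_rpow_abs_mul {x y e : ℝ} (hx : 0 < x) (hy : 0 < y) (hxy : x ≤ 2 * y)
    (hyx : y ≤ 2 * x) : x ^ e ≤ 2 ^ |e| * y ^ e := by
  rcases le_total 0 e with he | he
  · rw [abs_of_nonneg he, ← Real.mul_rpow (by norm_num) hy.le]
    exact Real.rpow_le_rpow hx.le hxy he
  · rw [abs_of_nonpos he, Real.rpow_neg (by norm_num), ← Real.inv_rpow (by norm_num),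
      ← Real.mul_rpow (by norm_num) hy.le]
    exact Real.rpow_le_rpow_of_nonpos (by positivity) (by linarith) he

/-- If `t ^ s ≤ c * e` and `e ≤ R`, then `t` and `e` are both of order at most `e ^ (1 / s)`. -/
theorem add_le_mul_rpow_inv {s c R t e : ℝ} (hs : 1 < s) (hc : 0 < c) (ht : 0 ≤ t) (he : 0 < e)
    (heR : e ≤ R) (hte : t ^ s ≤ c * e) :
    t + e ≤ (c ^ s⁻¹ + R ^ (1 - s⁻¹)) * e ^ s⁻¹ := by
  have hs0 : 0 < s := by linarith
  have hs1 : s⁻¹ ≤ 1 := inv_le_one_of_one_le₀ hs.le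
  have h1 : t ≤ c ^ s⁻¹ * e ^ s⁻¹ := by
    rw [← Real.mul_rpow hc.le he.le]
    exact (Real.le_rpow_inv_iff_of_pos ht (by positivity) hs0).2 hte
  have h2 : e ≤ R ^ (1 - s⁻¹) * e ^ s⁻¹ := by
    calc e = e ^ (1 - s⁻¹) * e ^ s⁻¹ := by rw [← Real.rpow_add he]; simp
      _ ≤ _ := by
        gcongr
  linarith

/-- Each term compares with ∫ r^(-sβ) dr over (t, t + κ e(t)]: there r ≤ A e(t)^(1/s), so e(t)^(-β)
is at most a constant times r^(-sβ). The intervals are disjoint and r^(-sβ) is integrable at 0. -/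
theorem exists_sum_rpow_le_of_separated {s c R κ L β : ℝ} (hs : 1 < s) (hc : 0 < c) (hR : 0 < R)
    (hκ : 0 < κ) (hκ1 : κ ≤ 1) (hβ : 0 ≤ β) (hsβ : s * β < 1) :
    ∃ C : ℝ≥0, ∀ (T : Finset ℝ) (e : ℝ → ℝ), (∀ t ∈ T, 0 ≤ t ∧ t ≤ L) →
      (∀ t ∈ T, 0 < e t ∧ e t ≤ R ∧ t ^ s ≤ c * e t) →
      (∀ a ∈ T, ∀ b ∈ T, a < b → a + κ * e a ≤ b) →
      ∑ t ∈ T, ENNReal.ofReal (e t ^ (1 - β)) ≤ C := by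
  set A := c ^ s⁻¹ + R ^ (1 - s⁻¹) with hA
  have hA0 : 0 < A := by positivity
  have hs0 : 0 < s := by linarith
  set I := ∫⁻ t in Ioc 0 (L + κ * R), ENNReal.ofReal (t ^ (-(s * β))) with hI
  have hIt : I ≠ ∞ := by
    have := (intervalIntegral.intervalIntegrable_rpow' (a := 0) (b := L + κ * R)
      (r := -(s * β)) (by linarith)).1
    exact this.lintegral_lt_top.ne
  refine ⟨(ENNReal.ofReal (A ^ (s * β) * κ⁻¹) * I).toNNReal, fun T e hT he hsep => ?_⟩
  rw [ENNReal.coe_toNNReal (ENNReal.mul_ne_top ENNReal.ofReal_ne_top hIt)]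
  have hdisj : Set.PairwiseDisjoint (T : Set ℝ) fun t => Ioc t (t + κ * e t) := by
    intro a ha b hb hab
    rcases lt_or_gt_of_ne hab with h | h
    · exact Set.disjoint_left.2 fun x hx hx' =>
        absurd (hx.2.trans (hsep a ha b hb h)) (not_le.2 hx'.1)
    · exact Set.disjoint_left.2 fun x hx hx' =>
        absurd (hx'.2.trans (hsep b hb a ha h)) (not_le.2 hx.1)
  have hterm : ∀ t ∈ T, ENNReal.ofReal (e t ^ (1 - β)) ≤ ENNReal.ofReal (A ^ (s * β) * κ⁻¹) *
      ∫⁻ r in Ioc t (t + κ * e t), ENNReal.ofReal (r ^ (-(s * β))) := by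
    intro t ht
    obtain ⟨he0, heR, hte⟩ := he t ht
    have ht0 := (hT t ht).1
    have hlow : ∀ r ∈ Ioc t (t + κ * e t),
        ENNReal.ofReal (A ^ (-(s * β)) * e t ^ (-β)) ≤ ENNReal.ofReal (r ^ (-(s * β))) := by
      intro r hr
      refine ENNReal.ofReal_le_ofReal ?_
      have h1 := add_le_mul_rpow_inv hs hc ht0 he0 heR hte
      have h2 : r ≤ A * e t ^ s⁻¹ := by nlinarith [hr.2]
      have h3 : (A * e t ^ s⁻¹) ^ (-(s * β)) = A ^ (-(s * β)) * e t ^ (-β) := by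
        rw [Real.mul_rpow hA0.le (by positivity), ← Real.rpow_mul he0.le]
        congr 2
        field_simp
      rw [← h3]
      exact Real.rpow_le_rpow_of_nonpos (ht0.trans_lt hr.1) h2
        (neg_nonpos.2 (by positivity))
    calc ENNReal.ofReal (e t ^ (1 - β))
        = ENNReal.ofReal (A ^ (s * β) * κ⁻¹) * (ENNReal.ofReal (A ^ (-(s * β)) * e t ^ (-β)) *
            volume (Ioc t (t + κ * e t))) := by
          rw [Real.volume_Ioc, ← ENNReal.ofReal_mul (by positivity),
            ← ENNReal.ofReal_mul (by positivity), sub_eq_add_neg, Real.rpow_add he0,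
            Real.rpow_one, Real.rpow_neg hA0.le]
          congr 1
          field_simp
          ring
      _ ≤ _ := by
          gcongr
          rw [← setLIntegral_const]
          exact setLIntegral_mono' measurableSet_Ioc hlow
  calc ∑ t ∈ T, ENNReal.ofReal (e t ^ (1 - β))
      ≤ ∑ t ∈ T, ENNReal.ofReal (A ^ (s * β) * κ⁻¹) *
          ∫⁻ r in Ioc t (t + κ * e t), ENNReal.ofReal (r ^ (-(s * β))) := Finset.sum_le_sum hterm
    _ = ENNReal.ofReal (A ^ (s * β) * κ⁻¹) *
          ∫⁻ r in ⋃ t ∈ T, Ioc t (t + κ * e t), ENNReal.ofReal (r ^ (-(s * β))) := by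
        rw [← Finset.mul_sum, lintegral_biUnion_finset hdisj fun _ _ => measurableSet_Ioc]
    _ ≤ _ := by
        gcongr
        refine lintegral_mono_set (iUnion₂_subset fun t ht => Ioc_subset_Ioc (hT t ht).1 ?_)
        exact add_le_add (hT t ht).2 (mul_le_mul_of_nonneg_left (he t ht).2.1 hκ.le)

end RealEstimates

/-! ### Chains in s-John domains -/

section John

variable {n : ℕ}

/-- In an `s`-John domain every point `z` is connected to the centre by a chain of disjoint
Whitney balls, whose union `U` satisfies the shadow estimates and a weighted volume bound. -/
theorem IsSJohnDomain.exists_chain (hn : n ≠ 0) {s τ a b β : ℝ} (hs : 1 < s)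
    (hτ : τ ∈ Ioo (0 : ℝ) 1) (hβ : 0 ≤ β) (hsβ : s * β < 1) (hb : 0 ≤ b)
    (hθ : 0 ≤ n - a - 1 + β + b / s)
    {G : Set (EuclideanSpace ℝ (Fin n))} (hG : IsSJohnDomain s G) :
    ∃ x₀ ∈ G, ∃ (B : ℝ) (C : ℝ≥0), 0 < B ∧ ∀ z ∈ G, ∃ U, IsOpen U ∧ U ⊆ G ∧
      (∀ x ∈ U, dist x z ≤ B * Metric.infDist x (frontier G) ^ s⁻¹ ∧
        Metric.infDist z (frontier G) ≤ B * Metric.infDist x (frontier G) ^ s⁻¹) ∧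
      ∫⁻ x in U, ENNReal.ofReal (Metric.infDist x (frontier G) ^ (-a)) ≤
        C * ENNReal.ofReal (Metric.infDist z (frontier G) ^ (-b)) ∧
      ∀ (f : EuclideanSpace ℝ (Fin n) → ℝ) (h : EuclideanSpace ℝ (Fin n) → ℝ≥0∞),
        (∀ z ∈ G, ∀ w ∈ G, dist z w ≤ τ / 4 * Metric.infDist z (frontier G) →
          edist (f z) (f w) ≤ ∫⁻ x in whitneyBall τ G z, h x) →
        edist (f z) (f x₀) ≤ ∫⁻ x in U, h x := by
  obtain ⟨hGd, x₀, hx₀, c, hc, hJ⟩ := hG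
  obtain ⟨R, hR1, hR⟩ := exists_infDist_frontier_le hGd
  have hR0 : 0 < R := by linarith
  have hs0 : 0 < s := by linarith
  have hτ0 := hτ.1
  have hτ1 := hτ.2
  set d : EuclideanSpace ℝ (Fin n) → ℝ := fun x => Metric.infDist x (frontier G) with hd
  have hdpos : ∀ x ∈ G, 0 < d x := fun x hx => infDist_frontier_pos hn hGd hx
  have hdlip : ∀ x y, d x ≤ d y + dist x y := infDist_frontier_le_add
  obtain ⟨S, hS⟩ := exists_sum_rpow_le_of_separated (L := c) (κ := τ / 4) hs hc hR0
    (by positivity) (by linarith) hβ hsβ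
  set A := c ^ s⁻¹ + R ^ (1 - s⁻¹) with hA
  have hA0 : 0 < A := by positivity
  set ω := volume (Metric.ball (0 : EuclideanSpace ℝ (Fin n)) 1) with hω
  have hωt : ω ≠ ∞ := measure_ball_lt_top.ne
  set θ := (n : ℝ) - a - 1 + β + b / s with hθdef
  have hKt : ENNReal.ofReal (2 ^ |-a| * (R ^ θ * A ^ b)) * ω ≠ ∞ :=
    ENNReal.mul_ne_top ENNReal.ofReal_ne_top hωt
  refine ⟨x₀, hx₀, A * 2 ^ s⁻¹, (ENNReal.ofReal (2 ^ |-a| * (R ^ θ * A ^ b)) * ω).toNNReal * S,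
    by positivity, fun z hz => ?_⟩
  obtain ⟨l, γ, hl0, hlc, hγ, hγG, hγ0, hγl, hγd⟩ := hJ z hz
  have hlip : ∀ a ∈ Icc 0 l, ∀ b ∈ Icc 0 l, a ≤ b → dist (γ a) (γ b) ≤ b - a :=
    fun a ha b hb hab => hγ.dist_le ha hb hab
  -- For t ≤ d(z)/2 the curve is still at depth d(z)/2; afterwards the John condition gives the
  -- lower bound.
  obtain ⟨ρ₀, hρ₀, hρ⟩ : ∃ ρ₀ > 0, ∀ t ∈ Icc 0 l, ρ₀ ≤ τ / 4 * d (γ t) := by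
    refine ⟨τ / 4 * min (d z / 2) ((d z / 2) ^ s / c), ?_, fun t ht => ?_⟩
    · have := hdpos z hz
      positivity
    · gcongr
      rcases le_total t (d z / 2) with h | h
      · refine (min_le_left _ _).trans ?_
        have h1 := hdlip z (γ t)
        have h2 := hlip 0 ⟨le_rfl, hl0⟩ t ht ht.1
        rw [hγ0] at h2
        linarith
      · refine (min_le_right _ _).trans (le_trans ?_ (hγd t ht))
        have := hdpos z hz
        gcongr
  obtain ⟨T, hT1, hT2, hT3⟩ := exists_separated_chain hl0 hlip hρ₀ hρ
  have hTG : ∀ t ∈ T, γ t ∈ G := fun t ht => hγG (hT1 t ht)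
  have htd : ∀ t ∈ T, t ^ s ≤ c * d (γ t) := fun t ht => by
    have := hγd t (hT1 t ht)
    rwa [div_le_iff₀' hc] at this
  have hdt : ∀ t ∈ T, t + d (γ t) ≤ A * d (γ t) ^ s⁻¹ := fun t ht =>
    add_le_mul_rpow_inv hs hc (hT1 t ht).1 (hdpos _ (hTG t ht)) (hR _ (hTG t ht)) (htd t ht)
  have hzt : ∀ t ∈ T, dist (γ t) z ≤ t := fun t ht => by
    have h2 := hlip 0 ⟨le_rfl, hl0⟩ t (hT1 t ht) (hT1 t ht).1
    rw [hγ0, dist_comm] at h2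
    linarith
  have hdisj : Set.PairwiseDisjoint (T : Set ℝ) fun t => whitneyBall τ G (γ t) := by
    have key : ∀ a ∈ T, ∀ b ∈ T, a < b →
        Disjoint (whitneyBall τ G (γ a)) (whitneyBall τ G (γ b)) := by
      intro a ha b hb hab
      -- Radii τ/16 · d and separation τ/4 · d match the factor 4 required for disjointness.
      refine disjoint_ball_of_separated (d := d) hdlip (by positivity) (by linarith) ?_
      have := hT2 a ha b hb hab
      linarith
    intro a ha b hb hab
    rcases lt_or_gt_of_ne hab with h | h
    · exact key a ha b hb h
    · exact (key b hb a ha h).symm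
  refine ⟨⋃ t ∈ T, whitneyBall τ G (γ t), isOpen_biUnion fun _ _ => Metric.isOpen_ball,
    iUnion₂_subset fun t ht => whitneyBall_subset hn hτ hGd (hTG t ht), ?_, ?_, ?_⟩
  · intro x hx
    obtain ⟨t, ht, hxt⟩ := mem_iUnion₂.1 hx
    have hdt0 := hdpos _ (hTG t ht)
    obtain ⟨h1, h2⟩ := infDist_le_of_mem_whitneyBall hτ hxt
    change d x ≤ 17 / 16 * d (γ t) at h1
    change 15 / 16 * d (γ t) ≤ d x at h2
    have h3 : dist x (γ t) < τ / 16 * d (γ t) := hxt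
    have h4 : t + d (γ t) ≤ A * 2 ^ s⁻¹ * d x ^ s⁻¹ := by
      refine (hdt t ht).trans ?_
      rw [mul_assoc, ← Real.mul_rpow (by norm_num) (by linarith)]
      gcongr
      linarith
    have h5 := dist_triangle x (γ t) z
    have h6 := hdlip z (γ t)
    rw [dist_comm] at h6
    have h7 := hzt t ht
    constructor
    · nlinarith
    · linarith
  · have hball : ∀ t ∈ T, ∫⁻ x in whitneyBall τ G (γ t), ENNReal.ofReal (d x ^ (-a)) ≤
        ENNReal.ofReal (2 ^ |-a| * (R ^ θ * A ^ b)) * ω *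
          (ENNReal.ofReal (d z ^ (-b)) * ENNReal.ofReal (d (γ t) ^ (1 - β))) := by
      intro t ht
      have hdt0 := hdpos _ (hTG t ht)
      have hz0 := hdpos z hz
      have h1 : ∀ x ∈ whitneyBall τ G (γ t), ENNReal.ofReal (d x ^ (-a)) ≤
          ENNReal.ofReal (2 ^ |-a| * d (γ t) ^ (-a)) := by
        intro x hx
        obtain ⟨h1, h2⟩ := infDist_le_of_mem_whitneyBall hτ hx
        change d x ≤ 17 / 16 * d (γ t) at h1
        change 15 / 16 * d (γ t) ≤ d x at h2
        exact ENNReal.ofReal_le_ofReal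
          (rpow_le_two_rpow_abs_mul (by linarith) hdt0 (by linarith) (by linarith))
      have h2 : volume (whitneyBall τ G (γ t)) ≤ ENNReal.ofReal (d (γ t) ^ (n : ℝ)) * ω := by
        rw [whitneyBall, volume_ball_eq_ofReal_rpow_mul _ (by positivity)]
        gcongr
        exact mul_le_of_le_one_left hdt0.le (by linarith)
      have h3 : d (γ t) ^ (-(b / s)) ≤ A ^ b * d z ^ (-b) := by
        have h4 : d z ≤ A * d (γ t) ^ s⁻¹ := by
          have h5 := hdlip z (γ t)
          rw [dist_comm] at h5
          linarith [hdt t ht, hzt t ht]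
        have h5 : d z ^ b ≤ A ^ b * d (γ t) ^ (b / s) := by
          refine (Real.rpow_le_rpow hz0.le h4 hb).trans_eq ?_
          rw [Real.mul_rpow hA0.le (by positivity), ← Real.rpow_mul hdt0.le]
          congr 2
          field_simp
        rw [Real.rpow_neg hdt0.le, Real.rpow_neg hz0.le, ← div_eq_mul_inv,
          le_div_iff₀ (by positivity), inv_mul_le_iff₀ (by positivity)]
        linarith
      -- Splitting d^(n-a) = d^θ · d^(-b/s) · d^(1-β): the first factor is bounded since θ ≥ 0, the
      -- second becomes d(z)^(-b), the third is summable along the chain.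
      have h4 : d (γ t) ^ (-a) * d (γ t) ^ (n : ℝ) ≤
          (R ^ θ * A ^ b) * (d z ^ (-b) * d (γ t) ^ (1 - β)) := by
        calc d (γ t) ^ (-a) * d (γ t) ^ (n : ℝ)
            = d (γ t) ^ θ * d (γ t) ^ (-(b / s)) * d (γ t) ^ (1 - β) := by
              rw [← Real.rpow_add hdt0, ← Real.rpow_add hdt0, ← Real.rpow_add hdt0, hθdef]
              congr 1
              ring
          _ ≤ R ^ θ * (A ^ b * d z ^ (-b)) * d (γ t) ^ (1 - β) := by
              gcongr
              exact hR _ (hTG t ht)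
          _ = _ := by ring
      calc ∫⁻ x in whitneyBall τ G (γ t), ENNReal.ofReal (d x ^ (-a))
          ≤ ENNReal.ofReal (2 ^ |-a| * d (γ t) ^ (-a)) * volume (whitneyBall τ G (γ t)) := by
            rw [← setLIntegral_const]
            exact setLIntegral_mono' Metric.isOpen_ball.measurableSet h1
        _ ≤ ENNReal.ofReal (2 ^ |-a| * d (γ t) ^ (-a)) *
              (ENNReal.ofReal (d (γ t) ^ (n : ℝ)) * ω) := by gcongr
        _ = ENNReal.ofReal (2 ^ |-a| * (d (γ t) ^ (-a) * d (γ t) ^ (n : ℝ))) * ω := by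
            rw [← mul_assoc, ← ENNReal.ofReal_mul (by positivity), mul_assoc]
        _ ≤ ENNReal.ofReal (2 ^ |-a| * ((R ^ θ * A ^ b) *
              (d z ^ (-b) * d (γ t) ^ (1 - β)))) * ω := by gcongr
        _ = _ := by
            rw [← mul_assoc (2 ^ |-a| : ℝ), ENNReal.ofReal_mul (by positivity),
              ENNReal.ofReal_mul (p := d z ^ (-b)) (by positivity)]
            ring
    rw [lintegral_biUnion_finset hdisj fun _ _ => Metric.isOpen_ball.measurableSet]
    refine (Finset.sum_le_sum hball).trans ?_
    rw [← Finset.mul_sum, ← Finset.mul_sum, ENNReal.coe_mul, ENNReal.coe_toNNReal hKt]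
    have h1 := hS T (fun t => d (γ t)) (fun t ht => ⟨(hT1 t ht).1, (hT1 t ht).2.trans hlc⟩)
      (fun t ht => ⟨hdpos _ (hTG t ht), hR _ (hTG t ht), htd t ht⟩)
      (fun p hp q hq hpq => by
        have h1 := hT2 p hp q hq hpq
        have h2 := hlip p (hT1 p hp) q (hT1 q hq) hpq.le
        linarith)
    calc _ ≤ ENNReal.ofReal (2 ^ |-a| * (R ^ θ * A ^ b)) * ω *
          (ENNReal.ofReal (d z ^ (-b)) * S) := by gcongr
      _ = _ := by ring
  · intro f h hfh
    rw [lintegral_biUnion_finset hdisj fun _ _ => Metric.isOpen_ball.measurableSet]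
    have := hT3 (fun t => f (γ t)) (fun t => ∫⁻ x in whitneyBall τ G (γ t), h x)
      (fun p hp q hq hpq => hfh _ (hγG hp) _ (hγG hq) hpq)
    rwa [hγ0, hγl] at this

end John

/-! ### Summation over the domain and the Poincaré inequality -/

theorem lintegral_tsum_indicator_mul {α : Type*} [MeasurableSpace α] {μ : Measure α}
    {U : ℕ → Set α} {G : Set α} (hU : ∀ i, MeasurableSet (U i)) (hUG : ∀ i, U i ⊆ G)
    (m : ℕ → ℝ≥0∞) {φ : α → ℝ≥0∞} (hφ : Measurable φ) :
    ∫⁻ x in G, (∑' i, (U i).indicator (fun _ => m i) x) * φ x ∂μ =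
      ∑' i, m i * ∫⁻ x in U i, φ x ∂μ := by
  have h1 : ∀ x, (∑' i, (U i).indicator (fun _ => m i) x) * φ x =
      ∑' i, (U i).indicator (fun x => m i * φ x) x := fun x => by
    rw [← ENNReal.tsum_mul_right]
    refine tsum_congr fun i => ?_
    by_cases h : x ∈ U i <;> simp [h]
  simp only [h1]
  rw [lintegral_tsum fun i => ((hφ.const_mul _).indicator (hU i)).aemeasurable]
  refine tsum_congr fun i => ?_
  rw [lintegral_indicator (hU i), Measure.restrict_restrict (hU i),
    inter_eq_self_of_subset_left (hUG i), lintegral_const_mul _ hφ]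

section Poincare

variable {n : ℕ}

/-- Lindelöf gives a countable cover, which is then made disjoint. Bounded overlap of the balls is
not needed: each piece only has to stay near its centre. -/
theorem exists_partition_whitneyBall (hn : n ≠ 0) {τ : ℝ} (hτ : τ ∈ Ioo (0 : ℝ) 1)
    {G : Set (EuclideanSpace ℝ (Fin n))} (hG : IsBoundedDomain G) :
    ∃ (z : ℕ → EuclideanSpace ℝ (Fin n)) (P : ℕ → Set (EuclideanSpace ℝ (Fin n))),
      (∀ i, z i ∈ G) ∧ (∀ i, MeasurableSet (P i)) ∧ (∀ i, P i ⊆ whitneyBall τ G (z i)) ∧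
      Pairwise (Function.onFun Disjoint P) ∧ ⋃ i, P i = G := by
  have hnhds : ∀ x ∈ G, whitneyBall τ G x ∈ 𝓝[G] x := fun x hx => by
    refine mem_nhdsWithin_of_mem_nhds (Metric.ball_mem_nhds _ ?_)
    have := infDist_frontier_pos hn hG hx
    have := hτ.1
    positivity
  obtain ⟨t, htG, htc, hcov⟩ := TopologicalSpace.countable_cover_nhdsWithin hnhds
  have htne : t.Nonempty := by
    obtain ⟨x, hx⟩ := hG.2.1.nonempty
    obtain ⟨z, hz, -⟩ := mem_iUnion₂.1 (hcov hx)
    exact ⟨z, hz⟩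
  obtain ⟨z, rfl⟩ := htc.exists_eq_range htne
  have hzG : ∀ i, z i ∈ G := fun i => htG (mem_range_self i)
  refine ⟨z, disjointed fun i => whitneyBall τ G (z i), hzG,
    fun i => MeasurableSet.disjointed (fun j => Metric.isOpen_ball.measurableSet) i,
    fun i => disjointed_subset _ i, disjoint_disjointed _, ?_⟩
  rw [iUnion_disjointed]
  refine Subset.antisymm (iUnion_subset fun i => whitneyBall_subset hn hτ hG (hzG i)) ?_
  rwa [biUnion_range] at hcov

/-- The exponents for which the chain estimates close up. -/
theorem exists_chain_exponents {s p lam δ N q : ℝ} (hs : 1 < s) (hp : 1 < p) (hlam : lam < N)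
    (hsδ : s < (N + 1 - lam) / (1 - δ)) (hδ1 : δ < 1)
    (hpδ : (s * (N - 1) - lam + 1) / (N - s * (1 - δ) - lam + 1) < p)
    (hpq : p.HolderConjugate q) :
    ∃ b β : ℝ, 0 ≤ β ∧ s * β < 1 ∧ 0 < b ∧ b < N - lam ∧
      0 ≤ N - ((N - δ) * q - N / s * (q - 1)) - 1 + β + b / s := by
  have hs0 : 0 < s := by linarith
  have hr : 0 < p - 1 := by linarith
  have hq : q = 1 + 1 / (p - 1) := by
    have := hpq.conjugate_eq
    rw [this]
    field_simp
    ring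
  have hD : 0 < N - s * (1 - δ) - lam + 1 := by
    rw [lt_div_iff₀ (by linarith)] at hsδ
    linarith
  rw [div_lt_iff₀ hD] at hpδ
  -- This is the last condition at the excluded endpoint b = N - λ, β = 1/s. Multiplied by s(p - 1)
  -- it is the hypothesis on p, whose denominator is positive by the hypothesis on s.
  have hpos : 0 < N - ((N - δ) * q - N / s * (q - 1)) - 1 + (1 + N - lam) / s := by
    have : N - ((N - δ) * q - N / s * (q - 1)) - 1 + (1 + N - lam) / s =
        (p * (N - s * (1 - δ) - lam + 1) - (s * (N - 1) - lam + 1)) / (s * (p - 1)) := by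
      rw [hq]
      field_simp
      ring
    rw [this]
    exact div_pos (by linarith) (by positivity)
  set θ := N - ((N - δ) * q - N / s * (q - 1)) - 1 + (1 + N - lam) / s with hθ
  -- Moving off the endpoint by ε in b and ε/s in β costs 2ε/s, which must not exceed θ; the other
  -- bounds keep β ≥ 0 and b > 0.
  set ε := min (min 1 ((N - lam) / 2)) (s * θ / 2) with hε
  have hε0 : 0 < ε := lt_min (lt_min one_pos (by linarith)) (by positivity)
  have hε1 : ε ≤ 1 := (min_le_left _ _).trans (min_le_left _ _)
  have hε2 : ε ≤ (N - lam) / 2 := (min_le_left _ _).trans (min_le_right _ _)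
  have hε3 : ε ≤ s * θ / 2 := min_le_right _ _
  refine ⟨N - lam - ε, (1 - ε) / s, div_nonneg (by linarith) hs0.le, ?_, by linarith,
    by linarith, ?_⟩
  · rw [mul_div_cancel₀ _ hs0.ne']
    linarith
  · have h1 : 2 * ε / s ≤ θ := by
      rw [div_le_iff₀ hs0]
      linarith
    have h2 : N - ((N - δ) * q - N / s * (q - 1)) - 1 + (1 - ε) / s + (N - lam - ε) / s =
        θ - 2 * ε / s := by
      rw [hθ]
      field_simp
      ring
    rw [h2]
    linarith

/-- Mass of a disjoint family of pieces whose shadows contain `x`. -/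
theorem tsum_indicator_volume_le {P U : ℕ → Set (EuclideanSpace ℝ (Fin n))}
    (hPm : ∀ i, MeasurableSet (P i)) (hPd : Pairwise (Function.onFun Disjoint P))
    {x : EuclideanSpace ℝ (Fin n)} {r : ℝ} (hr : 0 < r)
    (h : ∀ i, x ∈ U i → P i ⊆ Metric.ball x r) :
    ∑' i, (U i).indicator (fun _ => volume (P i)) x ≤
      ENNReal.ofReal (r ^ (n : ℝ)) * volume (Metric.ball (0 : EuclideanSpace ℝ (Fin n)) 1) := by
  rw [← volume_ball_eq_ofReal_rpow_mul x hr]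
  calc ∑' i, (U i).indicator (fun _ => volume (P i)) x
      ≤ ∑' i, volume (P i ∩ Metric.ball x r) := by
        refine ENNReal.tsum_le_tsum fun i => ?_
        by_cases hi : x ∈ U i
        · rw [indicator_of_mem hi, inter_eq_self_of_subset_left (h i hi)]
        · rw [indicator_of_notMem hi]
          exact zero_le
    _ = volume (⋃ i, P i ∩ Metric.ball x r) := by
        rw [measure_iUnion (fun i j hij => (hPd hij).mono inter_subset_left inter_subset_left)
          fun i => (hPm i).inter measurableSet_ball]
    _ ≤ volume (Metric.ball x r) :=
        measure_mono (iUnion_subset fun i => inter_subset_right)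

theorem exists_lintegral_edist_le (hn : n ≠ 0) {s p lam δ τ : ℝ} (hs : 1 < s) (hp : 1 < p)
    (hlam₀ : 0 ≤ lam) (hlam : lam < n) (hδ : δ ∈ Ioo (0 : ℝ) 1) (hτ : τ ∈ Ioo (0 : ℝ) 1)
    (hsδ : s < ((n : ℝ) + 1 - lam) / (1 - δ))
    (hpδ : (s * ((n : ℝ) - 1) - lam + 1) / ((n : ℝ) - s * (1 - δ) - lam + 1) < p)
    {G : Set (EuclideanSpace ℝ (Fin n))} (hG : IsSJohnDomain s G)
    (hdim : upperMinkowskiDim (frontier G) ≤ ENNReal.ofReal lam) :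
    ∃ C : ℝ≥0, ∀ u : EuclideanSpace ℝ (Fin n) → ℝ, Measurable u → IntegrableOn u G →
      ∃ m : ℝ, ∫⁻ x in G, edist (u x) m ≤ C * fractionalEnergy p δ τ G u ^ (1 / p) := by
  have hGd : IsBoundedDomain G := hG.1
  have hGm : MeasurableSet G := hGd.1.measurableSet
  have hGt : volume G ≠ ∞ := hGd.2.2.measure_lt_top.ne
  have hpq := Real.HolderConjugate.conjExponent hp
  set q := p.conjExponent with hq
  have hp0 : 0 < p := by linarith
  have hq0 : 0 < q := hpq.symm.pos
  have hq1 : 0 ≤ q - 1 := hpq.symm.sub_one_pos.le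
  have hs0 : 0 < s := by linarith
  set d : EuclideanSpace ℝ (Fin n) → ℝ := fun x => Metric.infDist x (frontier G) with hd
  have hdm : Measurable d := (Metric.continuous_infDist_pt _).measurable
  have hdpos : ∀ x ∈ G, 0 < d x := fun x hx => infDist_frontier_pos hn hGd hx
  obtain ⟨R, hR1, hR⟩ := exists_infDist_frontier_le hGd
  obtain ⟨b, β, hβ, hsβ, hb, hbl, hθ⟩ :=
    exists_chain_exponents hs hp hlam hsδ hδ.2 hpδ hpq
  set a := ((n : ℝ) - δ) * q - n / s * (q - 1) with ha
  obtain ⟨x₀, hx₀, B, C₁, hB, hchain⟩ := hG.exists_chain hn hs hτ hβ hsβ hb.le hθ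
  obtain ⟨C₂, hC₂⟩ := exists_edist_average_whitneyBall_le hn hp hδ.1 hτ
  obtain ⟨z, P, hzG, hPm, hPW, hPd, hPU⟩ := exists_partition_whitneyBall hn hτ hGd
  choose U hUo hUG hUdist hUint hUf using fun i => hchain (z i) (hzG i)
  set N : EuclideanSpace ℝ (Fin n) → ℝ≥0∞ :=
    fun x => ∑' i, (U i).indicator (fun _ => volume (P i)) x with hN
  have hNm : Measurable N :=
    Measurable.tsum fun i => measurable_const.indicator (hUo i).measurableSet
  set ω := volume (Metric.ball (0 : EuclideanSpace ℝ (Fin n)) 1) with hω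
  have hωt : ω ≠ ∞ := measure_ball_lt_top.ne
  set C₃ := ENNReal.ofReal ((2 * B) ^ (n : ℝ)) * ω with hC₃
  have hC₃t : C₃ ≠ ∞ := ENNReal.mul_ne_top ENNReal.ofReal_ne_top hωt
  have hNle : ∀ x ∈ G, N x ≤ C₃ * ENNReal.ofReal (d x ^ ((n : ℝ) / s)) := by
    intro x hx
    have hx0 := hdpos x hx
    -- One B bounds the distance from x to z_i, the other the distance from z_i to a point of its
    -- piece, which is less than d(z_i).
    refine (tsum_indicator_volume_le (r := 2 * B * d x ^ s⁻¹) hPm hPd (by positivity)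
      fun i hi y hy => ?_).trans_eq ?_
    · obtain ⟨h1, h2⟩ := hUdist i x hi
      have h3 : dist y (z i) < τ / 16 * d (z i) := hPW i hy
      have h4 : τ / 16 * d (z i) ≤ 1 * d (z i) := by
        have := hτ.2
        have := hdpos (z i) (hzG i)
        gcongr
        linarith
      have h5 := dist_triangle_right y x (z i)
      rw [Metric.mem_ball]
      linarith
    · rw [Real.mul_rpow (by positivity) (by positivity), ← Real.rpow_mul hx0.le,
        ENNReal.ofReal_mul (by positivity), hC₃, inv_mul_eq_div]
      ring
  have hb_fin : ∫⁻ x in G, ENNReal.ofReal (d x ^ (-b)) ≠ ∞ :=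
    (lintegral_infDist_rpow_neg_lt_top (frontier_nonempty_of_isBoundedDomain hn hGd) hGt hlam₀
      hdim hb hbl).ne
  have hNa : ∫⁻ x in G, N x * ENNReal.ofReal (d x ^ (-a)) ≠ ∞ := by
    rw [lintegral_tsum_indicator_mul (fun i => (hUo i).measurableSet) hUG _
      (hdm.pow_const _).ennreal_ofReal]
    refine ne_top_of_le_ne_top (ENNReal.mul_ne_top (ENNReal.mul_ne_top ENNReal.coe_ne_top
      (ENNReal.ofReal_ne_top (r := 2 ^ |(-b)|))) hb_fin) (b := C₁ * _ * _) ?_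
    rw [← hPU, lintegral_iUnion hPm hPd, ← ENNReal.tsum_mul_left]
    refine ENNReal.tsum_le_tsum fun i => ?_
    calc volume (P i) * ∫⁻ x in U i, ENNReal.ofReal (d x ^ (-a))
        ≤ volume (P i) * (C₁ * ENNReal.ofReal (d (z i) ^ (-b))) := by
          gcongr
          exact hUint i
      _ = C₁ * (ENNReal.ofReal (d (z i) ^ (-b)) * volume (P i)) := by ring
      _ ≤ C₁ * (ENNReal.ofReal (2 ^ |(-b)|) * ∫⁻ x in P i, ENNReal.ofReal (d x ^ (-b))) := by
          refine mul_le_mul' le_rfl ?_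
          rw [← setLIntegral_const, ← lintegral_const_mul' _ _ ENNReal.ofReal_ne_top]
          refine setLIntegral_mono' (hPm i) fun x hx => ?_
          obtain ⟨h1, h2⟩ := infDist_le_of_mem_whitneyBall hτ (hPW i hx)
          change d x ≤ 17 / 16 * d (z i) at h1
          change 15 / 16 * d (z i) ≤ d x at h2
          have hz0 := hdpos (z i) (hzG i)
          rw [← ENNReal.ofReal_mul (by positivity)]
          exact ENNReal.ofReal_le_ofReal
            (rpow_le_two_rpow_abs_mul hz0 (by linarith) (by linarith) (by linarith))
      _ = _ := by ring
  set g : EuclideanSpace ℝ (Fin n) → ℝ≥0∞ :=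
    fun x => N x * ENNReal.ofReal (d x ^ (δ - n)) with hg
  have hgm : Measurable g := hNm.mul (hdm.pow_const _).ennreal_ofReal
  have hgq : ∫⁻ x in G, g x ^ q ≠ ∞ := by
    have hC₃q : C₃ ^ (q - 1) ≠ ∞ := ENNReal.rpow_ne_top_of_nonneg hq1 hC₃t
    refine ne_top_of_le_ne_top (ENNReal.mul_ne_top hC₃q hNa) ?_
    rw [← lintegral_const_mul' _ _ hC₃q]
    refine setLIntegral_mono' hGm fun x hx => ?_
    have hx0 := hdpos x hx
    -- One factor N is kept for Tonelli; the others are estimated pointwise.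
    have h1 : N x ^ q = N x * N x ^ (q - 1) := by
      conv_lhs => rw [show q = 1 + (q - 1) by ring]
      rw [ENNReal.rpow_add_of_nonneg _ _ zero_le_one hq1, ENNReal.rpow_one]
    calc g x ^ q = N x * N x ^ (q - 1) * ENNReal.ofReal (d x ^ ((δ - n) * q)) := by
          rw [hg]
          simp only
          rw [ENNReal.mul_rpow_of_nonneg _ _ hq0.le, h1,
            ENNReal.ofReal_rpow_of_nonneg (by positivity) hq0.le, ← Real.rpow_mul hx0.le]
      _ ≤ N x * (C₃ * ENNReal.ofReal (d x ^ ((n : ℝ) / s))) ^ (q - 1) *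
          ENNReal.ofReal (d x ^ ((δ - n) * q)) := by
          gcongr
          exact hNle x hx
      _ = C₃ ^ (q - 1) * (N x * (ENNReal.ofReal (d x ^ ((n : ℝ) / s * (q - 1))) *
            ENNReal.ofReal (d x ^ ((δ - n) * q)))) := by
          rw [ENNReal.mul_rpow_of_nonneg _ _ hq1,
            ENNReal.ofReal_rpow_of_nonneg (by positivity) hq1, ← Real.rpow_mul hx0.le]
          ring
      _ = _ := by
          rw [← ENNReal.ofReal_mul (by positivity), ← Real.rpow_add hx0]
          congr 4
          rw [ha]
          ring
  have hK₁ : ENNReal.ofReal (R ^ δ) * volume G ^ (1 / q) ≠ ∞ :=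
    ENNReal.mul_ne_top ENNReal.ofReal_ne_top
      (ENNReal.rpow_ne_top_of_nonneg (by positivity) hGt)
  have hK₂ : (∫⁻ x in G, g x ^ q) ^ (1 / q) ≠ ∞ :=
    ENNReal.rpow_ne_top_of_nonneg (by positivity) hgq
  refine ⟨C₂ * ((ENNReal.ofReal (R ^ δ) * volume G ^ (1 / q)).toNNReal +
    ((∫⁻ x in G, g x ^ q) ^ (1 / q)).toNNReal), fun u hu hui => ?_⟩
  obtain ⟨hloc, hnear⟩ := hC₂ G u hGd hu hui
  set avg : EuclideanSpace ℝ (Fin n) → ℝ := fun z => ⨍ y in whitneyBall τ G z, u y with havg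
  set K := scaledEnergy p δ τ G u with hK
  have hKm : Measurable K := measurable_scaledEnergy hGm hu
  set E : EuclideanSpace ℝ (Fin n) → ℝ≥0∞ := fun x => localEnergy p δ τ G u x ^ (1 / p) with hE
  have hEm : Measurable E := (measurable_localEnergy hGm hu).pow_const _
  have hEp : ∫⁻ x in G, E x ^ p = fractionalEnergy p δ τ G u := by
    refine lintegral_congr fun x => ?_
    rw [hE]
    simp only
    rw [← ENNReal.rpow_mul, one_div_mul_cancel hp0.ne', ENNReal.rpow_one]
    rfl
  set φ : EuclideanSpace ℝ (Fin n) → ℝ≥0∞ :=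
    fun x => ENNReal.ofReal (d x ^ (-(n : ℝ))) * K x with hφ
  have hφm : Measurable φ := (hdm.pow_const _).ennreal_ofReal.mul hKm
  refine ⟨avg x₀, ?_⟩
  have hpiece : ∀ i, ∫⁻ x in P i, edist (u x) (avg x₀) ≤
      (∫⁻ x in P i, C₂ * K x) + volume (P i) * ∫⁻ x in U i, C₂ * φ x := by
    intro i
    have h1 : edist (avg (z i)) (avg x₀) ≤ ∫⁻ x in U i, C₂ * φ x := by
      refine hUf i avg (fun x => C₂ * φ x) fun z hz w hw hzw => ?_
      rw [lintegral_const_mul' _ _ ENNReal.coe_ne_top]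
      exact hnear z hz w hw hzw
    calc ∫⁻ x in P i, edist (u x) (avg x₀)
        ≤ ∫⁻ x in P i, (C₂ * K x + ∫⁻ x in U i, C₂ * φ x) :=
          setLIntegral_mono' (hPm i) fun x hx => (edist_triangle _ (avg (z i)) _).trans
            (add_le_add (hloc _ (hzG i) x (hPW i hx)) h1)
      _ = _ := by
          rw [lintegral_add_right _ measurable_const, setLIntegral_const, mul_comm (volume _)]
  have hT₁ : ∫⁻ x in G, K x ≤ ENNReal.ofReal (R ^ δ) * volume G ^ (1 / q) *
      fractionalEnergy p δ τ G u ^ (1 / p) := by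
    have hH := ENNReal.lintegral_mul_le_Lp_mul_Lq (volume.restrict G) hpq
      hEm.aemeasurable (measurable_const (a := (1 : ℝ≥0∞))).aemeasurable
    simp only [Pi.mul_apply, mul_one, ENNReal.one_rpow, lintegral_const, one_mul,
      Measure.restrict_apply_univ, hEp] at hH
    calc ∫⁻ x in G, K x ≤ ∫⁻ x in G, ENNReal.ofReal (R ^ δ) * E x := by
          refine setLIntegral_mono' hGm fun x hx => ?_
          have hx0 := hdpos x hx
          have h1 := hR x hx
          have h2 := hδ.1
          rw [hK, scaledEnergy]
          gcongr
      _ ≤ ENNReal.ofReal (R ^ δ) *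
          (fractionalEnergy p δ τ G u ^ (1 / p) * volume G ^ (1 / q)) := by
          rw [lintegral_const_mul' _ _ ENNReal.ofReal_ne_top]
          gcongr
      _ = _ := by ring
  have hT₂ : ∫⁻ x in G, N x * φ x ≤ (∫⁻ x in G, g x ^ q) ^ (1 / q) *
      fractionalEnergy p δ τ G u ^ (1 / p) := by
    have hH := ENNReal.lintegral_mul_le_Lp_mul_Lq (volume.restrict G) hpq
      hEm.aemeasurable hgm.aemeasurable
    rw [hEp, mul_comm (fractionalEnergy p δ τ G u ^ (1 / p))] at hH
    refine le_trans (setLIntegral_mono' hGm fun x hx => ?_) hH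
    have hx0 := hdpos x hx
    have h1 : ENNReal.ofReal (d x ^ (δ - n)) =
        ENNReal.ofReal (d x ^ (-(n : ℝ))) * ENNReal.ofReal (d x ^ δ) := by
      rw [← ENNReal.ofReal_mul (by positivity), ← Real.rpow_add hx0]
      congr 2
      ring
    simp only [Pi.mul_apply, hg, hφ, h1, hK, scaledEnergy, hE]
    apply le_of_eq
    ring
  calc ∫⁻ x in G, edist (u x) (avg x₀) = ∑' i, ∫⁻ x in P i, edist (u x) (avg x₀) := by
        conv_lhs => rw [← hPU]
        exact lintegral_iUnion hPm hPd _
    _ ≤ ∑' i, ((∫⁻ x in P i, C₂ * K x) + volume (P i) * ∫⁻ x in U i, C₂ * φ x) :=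
        ENNReal.tsum_le_tsum hpiece
    _ = (∫⁻ x in G, C₂ * K x) + ∫⁻ x in G, N x * (C₂ * φ x) := by
        rw [ENNReal.tsum_add, ← lintegral_iUnion hPm hPd, hPU,
          lintegral_tsum_indicator_mul (fun i => (hUo i).measurableSet) hUG _
            (hφm.const_mul _)]
    _ = C₂ * ((∫⁻ x in G, K x) + ∫⁻ x in G, N x * φ x) := by
        simp only [mul_left_comm (N _)]
        rw [lintegral_const_mul' _ _ ENNReal.coe_ne_top,
          lintegral_const_mul' _ _ ENNReal.coe_ne_top, mul_add]
    _ ≤ C₂ * (ENNReal.ofReal (R ^ δ) * volume G ^ (1 / q) *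
          fractionalEnergy p δ τ G u ^ (1 / p) + (∫⁻ x in G, g x ^ q) ^ (1 / q) *
          fractionalEnergy p δ τ G u ^ (1 / p)) := by gcongr
    _ = _ := by
        rw [ENNReal.coe_mul, ENNReal.coe_add, ENNReal.coe_toNNReal hK₁, ENNReal.coe_toNNReal hK₂]
        ring

theorem fractionalEnergy_congr_ae {p δ τ : ℝ} {G : Set (EuclideanSpace ℝ (Fin n))}
    {u v : EuclideanSpace ℝ (Fin n) → ℝ} (h : u =ᵐ[volume.restrict G] v) :
    fractionalEnergy p δ τ G u = fractionalEnergy p δ τ G v := by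
  refine lintegral_congr_ae ?_
  filter_upwards [h] with x hx
  refine lintegral_congr_ae ?_
  filter_upwards [ae_mono (Measure.restrict_mono inter_subset_left le_rfl) h] with y hy
  rw [hx, hy]

end Poincare

theorem theorem5p1 {n : ℕ} (hn : 2 ≤ n) (s p lam δ τ : ℝ)
    (hs : 1 < s) (hp : 1 < p)
    (hlam₁ : (n : ℝ) - 1 ≤ lam) (hlam₂ : lam < n)
    (hδ : δ ∈ Set.Ioo (0 : ℝ) 1) (hτ : τ ∈ Set.Ioo (0 : ℝ) 1)
    (hsδ : s < ((n : ℝ) + 1 - lam) / (1 - δ))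
    (hpδ : (s * ((n : ℝ) - 1) - lam + 1) / ((n : ℝ) - s * (1 - δ) - lam + 1) < p)
    (G : Set (EuclideanSpace ℝ (Fin n))) (hG : IsSJohnDomain s G)
    (hdim : upperMinkowskiDim (frontier G) ≤ ENNReal.ofReal lam) :
    SupportsFractionalPoincare 1 p δ τ G := by
  have hn0 : n ≠ 0 := by omega
  have hn2 : (2 : ℝ) ≤ n := by exact_mod_cast hn
  have hGt : volume G ≠ ∞ := hG.1.2.2.measure_lt_top.ne
  have hG0 : volume G ≠ 0 := (hG.1.1.measure_pos volume hG.1.2.1.nonempty).ne'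
  obtain ⟨C, hC⟩ := exists_lintegral_edist_le hn0 hs hp (by linarith) hlam₂ hδ hτ hsδ hpδ hG hdim
  refine ⟨2 * C, fun u hu => ?_⟩
  have : IsFiniteMeasure (volume.restrict G) := ⟨by
    rw [Measure.restrict_apply_univ]; exact hGt.lt_top⟩
  have hui : IntegrableOn u G := hu.integrable (by
    rw [← ENNReal.ofReal_one]; exact ENNReal.ofReal_le_ofReal hp.le)
  -- Measurability of the local energy in x requires a Borel representative; all integrals are
  -- unchanged by it.
  set v := hu.1.mk u with hv
  have huv : u =ᵐ[volume.restrict G] v := hu.1.ae_eq_mk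
  obtain ⟨m, hm⟩ := hC v hu.1.stronglyMeasurable_mk.measurable (hui.congr huv)
  rw [← fractionalEnergy_congr_ae huv] at hm
  calc ∫⁻ x in G, ENNReal.ofReal (|u x - ⨍ y in G, u y| ^ (1 : ℝ))
      = ∫⁻ x in G, edist (u x) (⨍ y in G, u y) := by
        simp only [Real.rpow_one, edist_dist, Real.dist_eq]
    _ ≤ 2 * ∫⁻ x in G, edist (u x) m := lintegral_edist_average_le hG0 hGt hui m
    _ = 2 * ∫⁻ x in G, edist (v x) m := by
        congr 1
        refine lintegral_congr_ae ?_
        filter_upwards [huv] with x hx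
        rw [hx]
    _ ≤ 2 * (C * fractionalEnergy p δ τ G u ^ (1 / p)) := by gcongr
    _ = _ := by
        push_cast
        ring
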